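/- Let $G$ be a nontrivial finite nilpotent group of nilpotency class at most $2$. The Cayley machine $\mathcal C(G)$ is the automaton with state set $G$ and alphabet $G$ which, at state $g$ on input $a$, goes to state $ga$ and outputs $ga$. Started in state $g$, it defines a permutation $\mathcal C_g$ of the set $G^{\omega}$ of right-infinite words over $G$, namely $\mathcal C_g(a_1a_2a_3\cdots)=(ga_1)(ga_1a_2)(ga_1a_2a_3)\cdots$. Let $\mathcal G(\mathcal C(G))=\langle \mathcal C_g : g\in G\rangle$ be the automata group generated by $\mathcal C(G)$, a group of permutations of $G^\omega$. Then $\mathcal G(\mathcal C(G))$ is a cross-wired lamplighter group, i.e. it is isomorphic to a cocompact lattice in the isometry group of a Diestel–Leader graph: there are an integer $q\ge 2$ and a faithful, proper and cocompact action of the discrete group $\mathcal G(\mathcal C(G))$ by isometries (graph automorphisms) on the Diestel–Leader graph $\mathrm{DL}(q,q)$. Here $\mathrm{DL}(q,q)$ is defined as follows. Let $T$ be the $(q+1)$-regular tree with a Busemann function $\mathfrak h:T\to\mathbb Z$ with respect to a fixed end. The vertices of $\mathrm{DL}(q,q)$ are the pairs $(u,v)$ of vertices of $T$ with $\mathfrak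 h(u)+\mathfrak h(v)=0$, and $(u,v)$, $(u',v')$ are adjacent if and only if $u,u'$ are adjacent and $v,v'$ are adjacent in $T$. -/

import Mathlib

/-- An invertible letter-to-letter (Mealy) automaton with state set `Q` and alphabet `A`: in state
`q`, on input `a`, it outputs `out q a` and moves to the state `next q a`, and every `out q` is a
permutation of the alphabet. -/
structure InvertibleAutomaton (Q A : Type*) where
  next : Q → A → Q
  out : Q → Equiv.Perm A

namespace InvertibleAutomaton

variable {Q A : Type*}

/-- The state reached from `q` after reading the first `n` letters of the infinite word `w`. -/
def stateAt (M : InvertibleAutomaton Q A) (q : Q) (w : ℕ → A) : ℕ → Q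
  | 0 => q
  | n + 1 => M.next (M.stateAt q w n) (w n)

/-- The transformation of right-infinite words computed by the automaton started in state `q`. -/
def transform (M : InvertibleAutomaton Q A) (q : Q) (w : ℕ → A) : ℕ → A :=
  fun n => M.out (M.stateAt q w n) (w n)

/-- The inverse automaton, obtained by exchanging inputs and outputs. -/
def inverse (M : InvertibleAutomaton Q A) : InvertibleAutomaton Q A where
  next q b := M.next q ((M.out q).symm b)
  out q := (M.out q).symm

theorem stateAt_inverse_transform (M : InvertibleAutomaton Q A) (q : Q) (w : ℕ → A) (n : ℕ) :
    M.inverse.stateAt q (M.transform q w) n = M.stateAt q w n := by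
  induction n with
  | zero => rfl
  | succ n ih =>
    rw [stateAt, ih]
    simp [stateAt, inverse, transform]

theorem inverse_transform_transform (M : InvertibleAutomaton Q A) (q : Q) (w : ℕ → A) :
    M.inverse.transform q (M.transform q w) = w := by
  funext n
  have h := M.stateAt_inverse_transform q w n
  simp only [transform] at h ⊢
  rw [h]
  simp [inverse]

theorem inverse_inverse (M : InvertibleAutomaton Q A) : M.inverse.inverse = M := by
  simp [inverse]

/-- The permutation of the set of right-infinite words defined by the state `q`. -/
def statePerm (M : InvertibleAutomaton Q A) (q : Q) : Equiv.Perm (ℕ → A) where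
  toFun := M.transform q
  invFun := M.inverse.transform q
  left_inv := M.inverse_transform_transform q
  right_inv w := by
    have h := M.inverse.inverse_transform_transform q w
    rwa [M.inverse_inverse] at h

/-- The automata group: the group of permutations of the right-infinite words generated by the
transformations defined by the states. -/
def automataGroup (M : InvertibleAutomaton Q A) : Subgroup (Equiv.Perm (ℕ → A)) :=
  Subgroup.closure (Set.range M.statePerm)

end InvertibleAutomaton

/-- The Cayley machine of a group `G`: states and alphabet are `G`, and at state `g` on input `a`
the machine goes to state `g * a` and outputs `g * a`. -/
def cayleyMachine (G : Type*) [Group G] : InvertibleAutomaton G G where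
  next g a := g * a
  out g := Equiv.mulLeft g

/-- The vertices of the `(q + 1)`-regular tree, arranged in horocycles with respect to a fixed end.
A vertex on the horocycle `level` is a sequence `(label i)`, `i ≤ level`, of elements of
`{0, …, q - 1}` which vanishes for `i` close to `-∞` (it is extended by `0` to `i > level`). -/
@[ext]
structure HoroVertex (q : ℕ) where
  level : ℤ
  label : ℤ → ℕ
  label_lt : ∀ i, label i < q
  label_above : ∀ i, level < i → label i = 0
  label_below : ∃ m : ℤ, ∀ i, i < m → label i = 0

/-- The predecessor of a vertex, i.e. its neighbour in the direction of the fixed end: delete the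
last letter of the sequence. Every vertex is the predecessor of exactly `q` vertices. -/
def HoroVertex.pred {q : ℕ} (v : HoroVertex q) : HoroVertex q where
  level := v.level - 1
  label := fun i => if i < v.level then v.label i else 0
  label_lt i := by
    split
    · exact v.label_lt i
    · exact lt_of_le_of_lt (Nat.zero_le _) (v.label_lt i)
  label_above i hi := by
    rw [if_neg (by omega)]
  label_below := by
    obtain ⟨m, hm⟩ := v.label_below
    exact ⟨m, fun i hi => by simp [hm i hi]⟩

/-- The `(q + 1)`-regular tree. The function `HoroVertex.level` is its Busemann function with
respect to the fixed end (increasing in the direction away from the end). -/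
def regularTree (q : ℕ) : SimpleGraph (HoroVertex q) where
  Adj v w := v.pred = w ∨ w.pred = v
  symm := ⟨fun _ _ h => h.symm⟩
  loopless := ⟨fun v h => by
    have h' : v.pred.level = v.level := congrArg HoroVertex.level (h.elim id id)
    simp [HoroVertex.pred] at h'⟩

/-- The vertices of the Diestel–Leader graph `DL(p, q)`: pairs of vertices of the `(p + 1)`-regular
and the `(q + 1)`-regular tree whose Busemann functions add up to `0`. -/
def DLVertex (p q : ℕ) : Type :=
  {v : HoroVertex p × HoroVertex q // v.1.level + v.2.level = 0}

/-- The Diestel–Leader graph `DL(p, q)`: two vertices are adjacent if and only if both of their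
coordinates are adjacent in the respective trees. -/
def diestelLeader (p q : ℕ) : SimpleGraph (DLVertex p q) where
  Adj v w := (regularTree p).Adj v.1.1 w.1.1 ∧ (regularTree q).Adj v.1.2 w.1.2
  symm := ⟨fun _ _ h => ⟨h.1.symm, h.2.symm⟩⟩
  loopless := ⟨fun v h => (regularTree p).loopless.irrefl v.1.1 h.1⟩

section Actions

variable {Γ V : Type*} [Group Γ] {X : SimpleGraph V}

/-- An action of a discrete group by automorphisms (isometries) of a graph is proper if, for every
compact, i.e. finite, set `K` of vertices, only finitely many group elements move `K` to a set which
meets `K`. -/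
def IsProperGraphAction (φ : Γ →* (X ≃g X)) : Prop :=
  ∀ K : Set V, K.Finite → {γ : Γ | ((fun v => φ γ v) '' K ∩ K).Nonempty}.Finite

/-- An action by automorphisms of a graph is cocompact if the translates of some finite set of
vertices cover the vertex set. -/
def IsCocompactGraphAction (φ : Γ →* (X ≃g X)) : Prop :=
  ∃ K : Set V, K.Finite ∧ ∀ v : V, ∃ γ : Γ, ∃ u ∈ K, φ γ u = v

end Actions

/-- A group is a cross-wired lamplighter group if it is isomorphic to a cocompact lattice in the
isometry group of a Diestel–Leader graph `DL(q, q)`, `q ≥ 2`; that is, if it acts faithfully,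
properly and cocompactly by isometries on `DL(q, q)`. -/
def IsCrossWiredLamplighter (Γ : Type*) [Group Γ] : Prop :=
  ∃ q : ℕ, 2 ≤ q ∧ ∃ φ : Γ →* (diestelLeader q q ≃g diestelLeader q q),
    Function.Injective φ ∧ IsProperGraphAction φ ∧ IsCocompactGraphAction φ

/-!
The states of the Cayley machine generate the same group as `t`, the state `1`, together with the
multiplications of the first letter by elements of `G`. The lamps of this group are the conjugates
of these multiplications by the powers of `t`. In nilpotency class two the commutator of two lamps
is the translation by a central word, which is a product of central lamps at sites between the two,
so the lamps at the sites in an interval form the product of the subgroups given by the two halves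
of any subdivision.

The kernel of the level homomorphism sending `t` to `1` and all lamps to `0` is therefore `A * B`
with `A ⊓ B = 1`, where `A` is generated by the lamps at nonnegative sites and `B` by those at
negative sites. Conjugation by `t` maps `A` onto a subgroup of index `|G|` in `A`, conjugation by
`t⁻¹` does the same to `B`, and every element of the kernel is brought into `A` by a large power of
`t` and into `B` by a large power of `t⁻¹`. Hence the cosets of each subgroup are the vertices of a
`(|G| + 1)`-regular tree with a fixed end, and because `A` and `B` are complementary, the diagonal
action on the horocyclic product of the two trees is simply transitive on the vertices.
-/

open Set

section TreeCoverings

variable {X Y : Type*}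

theorem bijective_of_semiconj {p : X → X} {p' : Y → Y} {f : X → Y} (hf : Function.Semiconj f p p')
    (hlift : ∀ x v, p' v = f x → ∃! y, p y = x ∧ f y = v)
    (hmerge : ∀ x y, f x = f y → ∃ k, p^[k] x = p^[k] y)
    (htail : ∀ v, ∃ k, p'^[k] v ∈ range f) : Function.Bijective f := by
  constructor
  · have key : ∀ k x y, f x = f y → p^[k] x = p^[k] y → x = y := by
      intro k
      induction k with
      | zero => exact fun x y _ h => h
      | succ k ih =>
        intro x y hxy h
        have hp : p x = p y := ih _ _ (by rw [hf.eq, hf.eq, hxy]) h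
        exact (hlift (p x) (f x) (hf.eq x).symm).unique ⟨rfl, rfl⟩ ⟨hp.symm, hxy.symm⟩
    intro x y hxy
    obtain ⟨k, hk⟩ := hmerge x y hxy
    exact key k x y hxy hk
  · have key : ∀ k v, p'^[k] v ∈ range f → v ∈ range f := by
      intro k
      induction k with
      | zero => exact fun v h => h
      | succ k ih =>
        intro v h
        obtain ⟨x, hx⟩ := ih _ h
        obtain ⟨y, ⟨-, hy⟩, -⟩ := hlift x v hx.symm
        exact ⟨y, hy⟩
    intro v
    obtain ⟨k, hk⟩ := htail v
    exact key k v hk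

theorem exists_equiv_fin_apply_eq_zero {q : ℕ} [NeZero q] (hcard : Nat.card X = q) (D : Set X)
    (hD : D.Subsingleton) : ∃ e : X ≃ Fin q, ∀ x ∈ D, e x = 0 := by
  have : Finite X := Nat.finite_of_card_ne_zero (hcard.trans_ne (NeZero.ne q))
  let e := Finite.equivFinOfCardEq hcard
  obtain rfl | ⟨d, rfl⟩ := hD.eq_empty_or_singleton
  · exact ⟨e, by simp⟩
  · exact ⟨e.trans (Equiv.swap (e d) 0), by simp⟩

theorem exists_fiber_labelling {q : ℕ} [NeZero q] {f : X → Y}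
    (hcard : ∀ y, Nat.card {x // f x = y} = q) {D : Set X} (hD : D.InjOn f) :
    ∃ lab : X → Fin q, (∀ y i, ∃! x, f x = y ∧ lab x = i) ∧ ∀ x ∈ D, lab x = 0 := by
  have hfiber (y : Y) : ∃ e : {x // f x = y} ≃ Fin q, ∀ x, x.1 ∈ D → e x = 0 :=
    exists_equiv_fin_apply_eq_zero (hcard y) {x | x.1 ∈ D} fun x hx x' hx' =>
      Subtype.ext (hD hx hx' (x.2.trans x'.2.symm))
  choose e he using hfiber
  refine ⟨fun x => e (f x) ⟨x, rfl⟩, fun y i => ⟨(e y).symm i, ⟨((e y).symm i).2, ?_⟩, ?_⟩,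
    fun x hx => he _ _ hx⟩
  · have happly : ∀ z : {x // f x = y}, e (f z) ⟨z, rfl⟩ = e y z := by
      rintro ⟨x, rfl⟩
      rfl
    exact (happly _).trans ((e y).apply_symm_apply i)
  · rintro x ⟨rfl, rfl⟩
    simp only [Equiv.symm_apply_apply]

end TreeCoverings

namespace HoroVertex

variable {q : ℕ}

@[simp]
theorem pred_level (v : HoroVertex q) : v.pred.level = v.level - 1 :=
  rfl

theorem pred_label (v : HoroVertex q) (i : ℤ) :
    v.pred.label i = if i < v.level then v.label i else 0 :=
  rfl

theorem iterate_pred_level (v : HoroVertex q) (k : ℕ) : (pred^[k] v).level = v.level - k := by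
  induction k with
  | zero => simp
  | succ k ih =>
    rw [Function.iterate_succ_apply', pred_level, ih]
    push_cast
    ring

theorem iterate_pred_label (v : HoroVertex q) (k : ℕ) (i : ℤ) :
    (pred^[k] v).label i = if i ≤ v.level - k then v.label i else 0 := by
  induction k with
  | zero =>
    split_ifs with h
    · rfl
    · exact v.label_above i (by simpa using h)
  | succ k ih =>
    rw [Function.iterate_succ_apply', pred_label, iterate_pred_level, ih]
    grind

theorem exists_iterate_pred_label_eq_zero (v : HoroVertex q) :
    ∃ k : ℕ, ∀ i, (pred^[k] v).label i = 0 := by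
  obtain ⟨m, hm⟩ := v.label_below
  refine ⟨(v.level - m + 1).toNat, fun i => ?_⟩
  rw [iterate_pred_label]
  exact ite_eq_right_iff.2 fun hi => hm i (by omega)

theorem eq_of_pred_eq {v w : HoroVertex q} (hpred : v.pred = w.pred)
    (htop : v.label v.level = w.label w.level) : v = w := by
  have hlevel : v.level = w.level := by
    simpa using congrArg level hpred
  refine HoroVertex.ext hlevel (funext fun i => ?_)
  rcases lt_trichotomy i v.level with hi | rfl | hi
  · simpa only [pred_label, hi, hlevel ▸ hi, if_true] using congrFun (congrArg label hpred) i
  · rw [htop, hlevel]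
  · rw [v.label_above i hi, w.label_above i (hlevel ▸ hi)]

end HoroVertex

/-- A horocyclic description of the `(q + 1)`-regular tree on the vertex set `X`: `level` is the
Busemann function of an end, `pred x` the neighbour of `x` in the direction of that end, and `base`
a line starting at that end which every path towards the end joins. -/
structure IsHorocyclicTree {X : Type*} (q : ℕ) (level : X → ℤ) (pred : X → X) (base : ℤ → X) :
    Prop where
  level_pred : ∀ x, level (pred x) = level x - 1
  card_children : ∀ x, Nat.card {y // pred y = x} = q
  level_base : ∀ n, level (base n) = n
  pred_base : ∀ n, pred (base n) = base (n - 1)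
  exists_iterate_pred : ∀ x, ∃ k : ℕ, pred^[k] x = base (level x - k)

namespace IsHorocyclicTree

variable {X : Type*} {q : ℕ} {level : X → ℤ} {pred : X → X} {base : ℤ → X}

theorem iterate_pred_base (h : IsHorocyclicTree q level pred base) (n : ℤ) (k : ℕ) :
    pred^[k] (base n) = base (n - k) := by
  induction k with
  | zero => simp
  | succ k ih =>
    rw [Function.iterate_succ_apply', ih, h.pred_base]
    push_cast
    congr 1
    ring

theorem eventually_iterate_pred (h : IsHorocyclicTree q level pred base) (x : X) :
    ∀ᶠ k : ℕ in Filter.atTop, pred^[k] x = base (level x - k) := by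
  obtain ⟨k, hk⟩ := h.exists_iterate_pred x
  filter_upwards [Filter.eventually_ge_atTop k] with n hn
  obtain ⟨m, rfl⟩ := Nat.exists_eq_add_of_le' hn
  rw [Function.iterate_add_apply, hk, h.iterate_pred_base]
  push_cast
  congr 1
  ring

theorem injOn_pred_range_base (h : IsHorocyclicTree q level pred base) :
    (range base).InjOn pred := by
  rintro _ ⟨m, rfl⟩ _ ⟨n, rfl⟩ hmn
  have hlevel := congrArg level hmn
  rw [h.level_pred, h.level_pred, h.level_base, h.level_base] at hlevel
  rw [sub_left_injective hlevel]

/-- The horocyclic coordinates of a vertex: its level and the labels of all its ancestors. -/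
def coordinates (h : IsHorocyclicTree q level pred base) (lab : X → Fin q)
    (hlab : ∀ n, (lab (base n)).val = 0) (x : X) : HoroVertex q where
  level := level x
  label i := if i ≤ level x then lab (pred^[(level x - i).toNat] x) else 0
  label_lt i := by
    split
    · exact (lab _).isLt
    · exact (Nat.zero_le _).trans_lt (lab x).isLt
  label_above i hi := if_neg (by omega)
  label_below := by
    obtain ⟨k, hk⟩ := (h.eventually_iterate_pred x).exists_forall_of_atTop
    refine ⟨level x - k, fun i hi => ?_⟩
    rw [if_pos (by omega), hk _ (by omega)]
    exact hlab _

section Coordinates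

variable (h : IsHorocyclicTree q level pred base) {lab : X → Fin q}
  (hlab : ∀ n, (lab (base n)).val = 0)

include h

theorem coordinates_label (x : X) (i : ℤ) : (h.coordinates lab hlab x).label i =
    if i ≤ level x then (lab (pred^[(level x - i).toNat] x)).val else 0 :=
  rfl

theorem coordinates_label_level (x : X) : (h.coordinates lab hlab x).label (level x) = lab x := by
  simp [coordinates_label]

theorem coordinates_pred (x : X) :
    h.coordinates lab hlab (pred x) = (h.coordinates lab hlab x).pred := by
  refine HoroVertex.ext (h.level_pred x) (funext fun i => ?_)
  rw [HoroVertex.pred_label, coordinates_label]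
  by_cases hi : i < level x
  · obtain ⟨k, hk⟩ : ∃ k, (level x - i).toNat = k + 1 := Nat.exists_eq_add_one.2 (by omega)
    have hk' : (level (pred x) - i).toNat = k := by
      rw [h.level_pred]
      omega
    rw [if_pos (by rw [h.level_pred]; omega), if_pos (by exact hi), coordinates_label,
      if_pos hi.le, hk, hk', Function.iterate_succ_apply]
  · rw [if_neg (by rw [h.level_pred]; omega), if_neg (by exact hi)]

theorem coordinates_base_label (n i : ℤ) : (h.coordinates lab hlab (base n)).label i = 0 := by
  simp only [coordinates_label, h.iterate_pred_base, hlab, ite_self]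

theorem existsUnique_coordinates_eq (hbij : ∀ x i, ∃! y, pred y = x ∧ lab y = i) (x : X)
    (v : HoroVertex q) (hv : v.pred = h.coordinates lab hlab x) :
    ∃! y, pred y = x ∧ h.coordinates lab hlab y = v := by
  obtain ⟨y, ⟨hyx, hyl⟩, huniq⟩ := hbij x ⟨v.label v.level, v.label_lt _⟩
  refine ⟨y, ⟨hyx, HoroVertex.eq_of_pred_eq ?_ ?_⟩, ?_⟩
  · rw [← h.coordinates_pred hlab, hyx, hv]
  · exact (h.coordinates_label_level hlab y).trans (congrArg Fin.val hyl)
  · rintro z ⟨hzx, rfl⟩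
    exact huniq z ⟨hzx, Fin.ext (h.coordinates_label_level hlab z).symm⟩

theorem coordinates_bijective (hbij : ∀ x i, ∃! y, pred y = x ∧ lab y = i) :
    Function.Bijective (h.coordinates lab hlab) := by
  refine bijective_of_semiconj (h.coordinates_pred hlab)
    (h.existsUnique_coordinates_eq hlab hbij) ?_ ?_
  · intro x y hxy
    have hlevel : level x = level y := congrArg HoroVertex.level hxy
    obtain ⟨k, hx, hy⟩ := ((h.eventually_iterate_pred x).and (h.eventually_iterate_pred y)).exists
    exact ⟨k, by rw [hx, hy, hlevel]⟩
  · intro v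
    obtain ⟨k, hk⟩ := v.exists_iterate_pred_label_eq_zero
    refine ⟨k, base (v.level - k), HoroVertex.ext ?_ (funext fun i => ?_)⟩
    · rw [v.iterate_pred_level]
      exact h.level_base _
    · rw [hk, h.coordinates_base_label hlab]

end Coordinates

theorem exists_equiv_horoVertex [NeZero q] (h : IsHorocyclicTree q level pred base) :
    ∃ e : X ≃ HoroVertex q, (∀ x, (e x).level = level x) ∧ ∀ x, e (pred x) = (e x).pred := by
  obtain ⟨lab, hbij, hbase⟩ := exists_fiber_labelling h.card_children h.injOn_pred_range_base
  have hlab (n : ℤ) : (lab (base n)).val = 0 := by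
    rw [hbase _ ⟨n, rfl⟩, Fin.val_zero]
  exact ⟨Equiv.ofBijective _ (h.coordinates_bijective hlab hbij), fun _ => rfl,
    h.coordinates_pred hlab⟩

end IsHorocyclicTree

section CosetTrees

variable {Γ : Type*} [Group Γ]

theorem card_fiber_quotientMapOfLE {H K : Subgroup Γ} (hHK : H ≤ K) (x : Γ ⧸ K) :
    Nat.card {y // Subgroup.quotientMapOfLE hHK y = x} = H.relIndex K := by
  let e := Subgroup.quotientEquivProdOfLE hHK
  calc Nat.card {y // Subgroup.quotientMapOfLE hHK y = x}
      = Nat.card {z : (Γ ⧸ K) × K ⧸ H.subgroupOf K // z.1 = x} :=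
        Nat.card_congr (e.subtypeEquiv fun _ => Iff.rfl)
    _ = Nat.card ({z : Γ ⧸ K // z = x} × K ⧸ H.subgroupOf K) :=
        Nat.card_congr (Equiv.prodSubtypeFstEquivSubtypeProd (p := (· = x)))
    _ = H.relIndex K := by
        rw [Nat.card_prod, Nat.card_unique, one_mul]
        rfl

/-- A subgroup `A` of the kernel of `lev : Γ → ℤ` is confining for an element `t` of level `1` if
conjugation by `t` maps it into itself, as a subgroup of index `q`, and if the positive powers of
`t` bring every element of the kernel into it. Then `Γ` is the ascending HNN extension of `A`
along this conjugation, and it acts on the corresponding Bass–Serre tree, which fixes an end. -/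
structure IsConfining (lev : Γ →* Multiplicative ℤ) (t : Γ) (q : ℕ) (A : Subgroup Γ) : Prop where
  level_eq : lev t = Multiplicative.ofAdd 1
  le_ker : A ≤ lev.ker
  map_conj_le : A.map (MulAut.conj t).toMonoidHom ≤ A
  relIndex_map_conj : (A.map (MulAut.conj t).toMonoidHom).relIndex A = q
  exists_conj_pow_mem : ∀ γ ∈ lev.ker, ∃ k : ℕ, t ^ k * γ * (t ^ k)⁻¹ ∈ A

/-- An action on a horocyclically parametrised regular tree which preserves the end and translates
the Busemann function by `lev`. -/
structure IsHorocyclicAction {q : ℕ} (lev : Γ →* Multiplicative ℤ)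
    (ρ : Γ →* Equiv.Perm (HoroVertex q)) : Prop where
  level_apply : ∀ γ v, (ρ γ v).level = (lev γ).toAdd + v.level
  pred_apply : ∀ γ v, (ρ γ v).pred = ρ γ v.pred

namespace IsConfining

variable {lev : Γ →* Multiplicative ℤ} {t : Γ} {q : ℕ} {A : Subgroup Γ}

theorem conj_mem (hA : IsConfining lev t q A) {a : Γ} (ha : a ∈ A) : t * a * t⁻¹ ∈ A :=
  hA.map_conj_le ⟨a, ha, rfl⟩

/-- The level of the vertices of the coset tree of a confining subgroup. -/
def cosetLevel (hA : IsConfining lev t q A) : Γ ⧸ A → ℤ :=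
  Quotient.lift (fun γ => (lev γ).toAdd) fun γ δ hγδ => by
    have h : lev (γ⁻¹ * δ) = 1 := hA.le_ker (QuotientGroup.leftRel_apply.1 hγδ)
    rw [map_mul, map_inv, inv_mul_eq_one] at h
    exact congrArg Multiplicative.toAdd h

/-- The predecessor map `γA ↦ γt⁻¹A` of the coset tree of a confining subgroup. -/
def cosetPred (hA : IsConfining lev t q A) : Γ ⧸ A → Γ ⧸ A :=
  Quotient.map (· * t⁻¹) fun γ δ hγδ => by
    rw [← Quotient.eq_iff_equiv, Quotient.eq, QuotientGroup.leftRel_apply] at hγδ ⊢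
    simpa [mul_assoc] using hA.conj_mem hγδ

theorem cosetLevel_mk (hA : IsConfining lev t q A) (γ : Γ) :
    hA.cosetLevel (γ : Γ ⧸ A) = (lev γ).toAdd :=
  rfl

theorem cosetPred_mk (hA : IsConfining lev t q A) (γ : Γ) :
    hA.cosetPred (γ : Γ ⧸ A) = ((γ * t⁻¹ : Γ) : Γ ⧸ A) :=
  rfl

theorem iterate_cosetPred_mk (hA : IsConfining lev t q A) (γ : Γ) (k : ℕ) :
    hA.cosetPred^[k] (γ : Γ ⧸ A) = ((γ * (t ^ k)⁻¹ : Γ) : Γ ⧸ A) := by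
  induction k with
  | zero => simp
  | succ k ih =>
    rw [Function.iterate_succ_apply', ih, cosetPred_mk, mul_assoc, ← mul_inv_rev, ← pow_succ']

theorem card_fiber_cosetPred (hA : IsConfining lev t q A) (x : Γ ⧸ A) :
    Nat.card {y // hA.cosetPred y = x} = q := by
  let e : Γ ⧸ A ≃ Γ ⧸ A.map (MulAut.conj t).toMonoidHom :=
    Quotient.congr (Equiv.mulRight t⁻¹) fun γ δ => by
      rw [QuotientGroup.leftRel_apply, QuotientGroup.leftRel_apply, Subgroup.mem_map_equiv]
      simp [mul_assoc]
  have hpred (y : Γ ⧸ A) : hA.cosetPred y = Subgroup.quotientMapOfLE hA.map_conj_le (e y) := by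
    obtain ⟨γ, rfl⟩ := QuotientGroup.mk_surjective y
    rfl
  simp only [hpred]
  rw [Nat.card_congr (e.subtypeEquiv (q := fun z => Subgroup.quotientMapOfLE _ z = x)
    fun _ => Iff.rfl), card_fiber_quotientMapOfLE hA.map_conj_le x, hA.relIndex_map_conj]

theorem isHorocyclicTree_coset (hA : IsConfining lev t q A) :
    IsHorocyclicTree q hA.cosetLevel hA.cosetPred fun n => ((t ^ n : Γ) : Γ ⧸ A) where
  level_pred x := by
    obtain ⟨γ, rfl⟩ := QuotientGroup.mk_surjective x
    simp only [cosetPred_mk, cosetLevel_mk, map_mul, map_inv, hA.level_eq, toAdd_mul, toAdd_inv,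
      toAdd_ofAdd, sub_eq_add_neg]
  card_children := hA.card_fiber_cosetPred
  level_base n := by simp [cosetLevel_mk, hA.level_eq]
  pred_base n := by rw [cosetPred_mk, ← zpow_sub_one]
  exists_iterate_pred x := by
    obtain ⟨γ, rfl⟩ := QuotientGroup.mk_surjective x
    set n := (lev γ).toAdd with hn
    have hker : γ⁻¹ * t ^ n ∈ lev.ker := by
      rw [MonoidHom.mem_ker, map_mul, map_inv, map_zpow, hA.level_eq, inv_mul_eq_one,
        ← ofAdd_zsmul, hn]
      simp
    obtain ⟨k, hk⟩ := hA.exists_conj_pow_mem _ hker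
    refine ⟨k, ?_⟩
    rw [iterate_cosetPred_mk, cosetLevel_mk, ← hn, QuotientGroup.eq]
    convert hk using 1
    rw [zpow_sub, zpow_natCast]
    group

theorem exists_isHorocyclicAction [NeZero q] (hA : IsConfining lev t q A) :
    ∃ (ρ : Γ →* Equiv.Perm (HoroVertex q)) (v₀ : HoroVertex q), IsHorocyclicAction lev ρ ∧
      v₀.level = 0 ∧ (∀ γ, ρ γ v₀ = v₀ ↔ γ ∈ A) ∧ ∀ v, ∃ γ, ρ γ v₀ = v := by
  obtain ⟨e, he_level, he_pred⟩ := hA.isHorocyclicTree_coset.exists_equiv_horoVertex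
  let ρ : Γ →* Equiv.Perm (HoroVertex q) :=
    e.permCongrHom.toMonoidHom.comp (MulAction.toPermHom Γ (Γ ⧸ A))
  have hρ (γ δ : Γ) : ρ γ (e (δ : Γ ⧸ A)) = e ((γ * δ : Γ) : Γ ⧸ A) :=
    congrArg (fun x : Γ ⧸ A => e (γ • x)) (e.symm_apply_apply _)
  have hsurj (v : HoroVertex q) : ∃ δ : Γ, e (δ : Γ ⧸ A) = v :=
    (e.surjective.comp QuotientGroup.mk_surjective) v
  refine ⟨ρ, e ((1 : Γ) : Γ ⧸ A), ⟨fun γ v => ?_, fun γ v => ?_⟩, ?_, fun γ => ?_, fun v => ?_⟩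
  · obtain ⟨δ, rfl⟩ := hsurj v
    rw [hρ, he_level, he_level, cosetLevel_mk, cosetLevel_mk, map_mul, toAdd_mul]
  · obtain ⟨δ, rfl⟩ := hsurj v
    rw [hρ, ← he_pred, ← he_pred, cosetPred_mk, cosetPred_mk, hρ, mul_assoc]
  · rw [he_level, cosetLevel_mk, map_one, toAdd_one]
  · rw [hρ, e.apply_eq_iff_eq, eq_comm, QuotientGroup.eq, inv_one, one_mul, mul_one]
  · obtain ⟨δ, rfl⟩ := hsurj v
    exact ⟨δ, by rw [hρ, mul_one]⟩

end IsConfining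

theorem IsHorocyclicAction.adj_iff {q : ℕ} {lev : Γ →* Multiplicative ℤ}
    {ρ : Γ →* Equiv.Perm (HoroVertex q)} (hρ : IsHorocyclicAction lev ρ) (γ : Γ)
    (v w : HoroVertex q) : (regularTree q).Adj (ρ γ v) (ρ γ w) ↔ (regularTree q).Adj v w := by
  simp only [regularTree, hρ.pred_apply, (ρ γ).apply_eq_iff_eq]

end CosetTrees

section DiestelLeaderActions

variable {Γ : Type*} [Group Γ] {p q : ℕ} {lev : Γ →* Multiplicative ℤ}
  {ρ : Γ →* Equiv.Perm (HoroVertex p)} {σ : Γ →* Equiv.Perm (HoroVertex q)}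

/-- The action on a Diestel–Leader graph assembled from actions on the two trees which translate
the Busemann functions by opposite amounts. -/
def diestelLeaderHom (hρ : IsHorocyclicAction lev ρ) (hσ : IsHorocyclicAction lev⁻¹ σ) :
    Γ →* (diestelLeader p q ≃g diestelLeader p q) where
  toFun γ :=
    { toEquiv := ((ρ γ).prodCongr (σ γ)).subtypeEquiv fun v => by
        simp only [Equiv.prodCongr_apply, Prod.map, hρ.level_apply, hσ.level_apply,
          MonoidHom.inv_apply, toAdd_inv]
        omega
      map_rel_iff' := and_congr (hρ.adj_iff γ _ _) (hσ.adj_iff γ _ _) }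
  map_one' := RelIso.ext fun v => Subtype.ext <|
    Prod.ext (congrFun (congrArg DFunLike.coe (map_one ρ)) _)
      (congrFun (congrArg DFunLike.coe (map_one σ)) _)
  map_mul' γ δ := RelIso.ext fun v => Subtype.ext <|
    Prod.ext (congrFun (congrArg DFunLike.coe (map_mul ρ γ δ)) _)
      (congrFun (congrArg DFunLike.coe (map_mul σ γ δ)) _)

theorem exists_bijective_diestelLeader_orbit_map [NeZero p] [NeZero q] {t : Γ} {A B : Subgroup Γ}
    (hA : IsConfining lev t p A) (hB : IsConfining lev⁻¹ t⁻¹ q B) (hAB : Disjoint A B)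
    (hker : ∀ γ ∈ lev.ker, ∃ a ∈ A, ∃ b ∈ B, a * b = γ) :
    ∃ (φ : Γ →* (diestelLeader p q ≃g diestelLeader p q)) (o : DLVertex p q),
      Function.Bijective fun γ => φ γ o := by
  obtain ⟨ρ, u, hρ, hu, hu_fix, hu_orbit⟩ := hA.exists_isHorocyclicAction
  obtain ⟨σ, v, hσ, hv, hv_fix, hv_orbit⟩ := hB.exists_isHorocyclicAction
  refine ⟨diestelLeaderHom hρ hσ, ⟨(u, v), by rw [hu, hv, add_zero]⟩, fun γ δ hγδ => ?_, ?_⟩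
  · have hu' : ρ γ u = ρ δ u := congrArg (fun w : DLVertex p q => w.1.1) hγδ
    have hv' : σ γ v = σ δ v := congrArg (fun w : DLVertex p q => w.1.2) hγδ
    have hmemA : γ⁻¹ * δ ∈ A := by
      rw [← hu_fix, map_mul, map_inv, Equiv.Perm.mul_apply, Equiv.Perm.inv_eq_iff_eq, hu']
    have hmemB : γ⁻¹ * δ ∈ B := by
      rw [← hv_fix, map_mul, map_inv, Equiv.Perm.mul_apply, Equiv.Perm.inv_eq_iff_eq, hv']
    exact inv_mul_eq_one.1 (Subgroup.disjoint_def.1 hAB hmemA hmemB)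
  · rintro ⟨⟨x, y⟩, hxy⟩
    obtain ⟨γ, rfl⟩ := hu_orbit x
    obtain ⟨δ, rfl⟩ := hv_orbit y
    have hlevel : γ⁻¹ * δ ∈ lev.ker := by
      simp only [hρ.level_apply, hσ.level_apply, hu, hv, MonoidHom.inv_apply, toAdd_inv] at hxy
      rw [MonoidHom.mem_ker, map_mul, map_inv, inv_mul_eq_one]
      exact Multiplicative.toAdd.injective (by omega)
    obtain ⟨a, ha, b, hb, hab⟩ := hker _ hlevel
    have hu' : ρ (γ * a) u = ρ γ u := by
      rw [map_mul, Equiv.Perm.mul_apply, (hu_fix a).2 ha]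
    have hv' : σ (γ * a) v = σ δ v := by
      have hδ : γ * a = δ * b⁻¹ := by
        rw [eq_mul_inv_iff_mul_eq, mul_assoc, hab, mul_inv_cancel_left]
      rw [hδ, map_mul, Equiv.Perm.mul_apply, (hv_fix _).2 (inv_mem hb)]
    exact ⟨γ * a, Subtype.ext (Prod.ext hu' hv')⟩

end DiestelLeaderActions

section OrbitMaps

variable {Γ V : Type*} [Group Γ] {X : SimpleGraph V} {φ : Γ →* (X ≃g X)} {o : V}

theorem injective_of_injective_orbit_map (hφ : Function.Injective fun γ => φ γ o) :
    Function.Injective φ :=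
  fun _ _ h => hφ (congrArg (fun f : X ≃g X => f o) h)

theorem isProperGraphAction_of_bijective_orbit_map (hφ : Function.Bijective fun γ => φ γ o) :
    IsProperGraphAction φ := by
  intro K hK
  have hF : {γ | φ γ o ∈ K}.Finite := hK.preimage hφ.injective.injOn
  refine (hF.image2 (fun β α => β * α⁻¹) hF).subset ?_
  rintro γ ⟨_, ⟨v, hv, rfl⟩, hγv⟩
  obtain ⟨α, rfl⟩ := hφ.surjective v
  have hγα : φ (γ * α) o ∈ K := by
    rw [map_mul]
    exact hγv
  exact ⟨γ * α, hγα, α, hv, mul_inv_cancel_right γ α⟩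

theorem isCocompactGraphAction_of_surjective_orbit_map
    (hφ : Function.Surjective fun γ => φ γ o) : IsCocompactGraphAction φ :=
  ⟨{o}, finite_singleton o, fun v => (hφ v).imp fun _ hγ => ⟨o, rfl, hγ⟩⟩

end OrbitMaps

theorem isCrossWiredLamplighter_of_isConfining {Γ : Type*} [Group Γ] {q : ℕ} (hq : 2 ≤ q)
    {lev : Γ →* Multiplicative ℤ} {t : Γ} {A B : Subgroup Γ} (hA : IsConfining lev t q A)
    (hB : IsConfining lev⁻¹ t⁻¹ q B) (hAB : Disjoint A B)
    (hker : ∀ γ ∈ lev.ker, ∃ a ∈ A, ∃ b ∈ B, a * b = γ) : IsCrossWiredLamplighter Γ := by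
  have : NeZero q := ⟨by omega⟩
  obtain ⟨φ, o, hφ⟩ := exists_bijective_diestelLeader_orbit_map hA hB hAB hker
  exact ⟨q, hq, φ, injective_of_injective_orbit_map hφ.injective,
    isProperGraphAction_of_bijective_orbit_map hφ,
    isCocompactGraphAction_of_surjective_orbit_map hφ.surjective⟩

section Subgroups

open scoped commutatorElement

variable {P : Type*} [Group P]

theorem commutator_closure_le {s : Set P} {N : Subgroup P}
    (hs : Subgroup.closure s ≤ Subgroup.normalizer (N : Set P))
    (h : ∀ x ∈ s, ∀ y ∈ s, ⁅x, y⁆ ∈ N) : ⁅Subgroup.closure s, Subgroup.closure s⁆ ≤ N := by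
  rw [Subgroup.commutator_le]
  intro x hx y hy
  have hconj {a n : P} (ha : a ∈ Subgroup.normalizer (N : Set P)) (hn : n ∈ N) :
      a * n * a⁻¹ ∈ N := (Subgroup.mem_normalizer_iff.1 ha n).1 hn
  induction hx, hy using Subgroup.closure_induction₂ with
  | mem x y hx hy => exact h x hx y hy
  | one_left y _ => simp [N.one_mem]
  | one_right x _ => simp [N.one_mem]
  | mul_left x₁ x₂ y hx₁ _ _ h₁ h₂ =>
    have hmul : ⁅x₁ * x₂, y⁆ = x₁ * ⁅x₂, y⁆ * x₁⁻¹ * ⁅x₁, y⁆ := by group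
    exact hmul ▸ mul_mem (hconj (hs hx₁) h₂) h₁
  | mul_right y₁ y₂ x hy₁ _ _ h₁ h₂ =>
    have hmul : ⁅x, y₁ * y₂⁆ = ⁅x, y₁⁆ * (y₁ * ⁅x, y₂⁆ * y₁⁻¹) := by group
    exact hmul ▸ mul_mem h₁ (hconj (hs hy₁) h₂)
  | inv_left x y hx _ h =>
    have hinv : ⁅x⁻¹, y⁆ = x⁻¹ * ⁅x, y⁆⁻¹ * x⁻¹⁻¹ := by group
    exact hinv ▸ hconj (inv_mem (hs hx)) (inv_mem h)
  | inv_right x y _ hy h =>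
    have hinv : ⁅x, y⁻¹⁆ = y⁻¹ * ⁅x, y⁆⁻¹ * y⁻¹⁻¹ := by group
    exact hinv ▸ hconj (inv_mem (hs hy)) (inv_mem h)

theorem exists_mul_eq_of_mem_sup {A B : Subgroup P}
    (h : ∀ a ∈ A, ∀ b ∈ B, ∃ a' ∈ A, ∃ b' ∈ B, a' * b' = b * a) {x : P} (hx : x ∈ A ⊔ B) :
    ∃ a ∈ A, ∃ b ∈ B, a * b = x := by
  rw [← A.closure_eq, ← B.closure_eq, ← Subgroup.closure_union] at hx
  induction hx using Subgroup.closure_induction with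
  | mem x hx =>
    rcases hx with hx | hx
    · exact ⟨x, hx, 1, one_mem B, mul_one x⟩
    · exact ⟨1, one_mem A, x, hx, one_mul x⟩
  | one => exact ⟨1, one_mem A, 1, one_mem B, mul_one 1⟩
  | mul x y _ _ hx hy =>
    obtain ⟨a₁, ha₁, b₁, hb₁, rfl⟩ := hx
    obtain ⟨a₂, ha₂, b₂, hb₂, rfl⟩ := hy
    obtain ⟨a, ha, b, hb, hab⟩ := h a₂ ha₂ b₁ hb₁
    refine ⟨a₁ * a, mul_mem ha₁ ha, b * b₂, mul_mem hb hb₂, ?_⟩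
    rw [mul_assoc, ← mul_assoc a, hab]
    simp only [mul_assoc]
  | inv x _ hx =>
    obtain ⟨a, ha, b, hb, rfl⟩ := hx
    obtain ⟨a', ha', b', hb', hab⟩ := h a⁻¹ (inv_mem ha) b⁻¹ (inv_mem hb)
    exact ⟨a', ha', b', hb', by rw [hab, mul_inv_rev]⟩

theorem relIndex_sup_eq_card {H K : Subgroup P} (hHK : Disjoint H K)
    (hmul : ∀ x ∈ H ⊔ K, ∃ h ∈ H, ∃ k ∈ K, h * k = x) : K.relIndex (H ⊔ K) = Nat.card H := by
  have hcompl : (H.subgroupOf (H ⊔ K)).IsComplement' (K.subgroupOf (H ⊔ K)) := by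
    refine Subgroup.isComplement'_of_disjoint_and_mul_eq_univ ?_ (eq_univ_of_forall ?_)
    · rw [disjoint_iff, Subgroup.subgroupOf, Subgroup.subgroupOf, ← Subgroup.comap_inf,
        hHK.eq_bot, ← Subgroup.subgroupOf, Subgroup.bot_subgroupOf]
    · rintro ⟨x, hx⟩
      obtain ⟨h, hh, k, hk, rfl⟩ := hmul x hx
      exact ⟨⟨h, le_sup_left (a := H) hh⟩, hh, ⟨k, le_sup_right (a := H) hk⟩, hk, rfl⟩
  rw [Subgroup.relIndex, hcompl.index_eq_card]
  exact Nat.card_congr (Subgroup.subgroupOfEquivOfLe le_sup_left).toEquiv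

theorem exists_hom_ker_eq_of_sup_zpowers_eq_top {N : Subgroup P} [N.Normal] {t : P}
    (hsup : N ⊔ Subgroup.zpowers t = ⊤) (ht : ∀ n : ℤ, t ^ n ∈ N → n = 0) :
    ∃ lev : P →* Multiplicative ℤ, lev t = Multiplicative.ofAdd 1 ∧ lev.ker = N := by
  let pow : Multiplicative ℤ →* P ⧸ N := zpowersHom (P ⧸ N) (t : P ⧸ N)
  have hpow (n : ℤ) : pow (Multiplicative.ofAdd n) = ((t ^ n : P) : P ⧸ N) := rfl
  have hinj : Function.Injective pow := by
    refine (injective_iff_map_eq_one pow).2 fun n hn => ?_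
    exact ht n.toAdd ((QuotientGroup.eq_one_iff _).1 hn)
  have hsurj : Function.Surjective pow := by
    intro x
    obtain ⟨γ, rfl⟩ := QuotientGroup.mk_surjective x
    have hγ : γ ∈ N ⊔ Subgroup.zpowers t := hsup ▸ Subgroup.mem_top γ
    obtain ⟨a, ha, _, ⟨n, rfl⟩, rfl⟩ := Subgroup.mem_sup_of_normal_left.1 hγ
    refine ⟨Multiplicative.ofAdd n, ?_⟩
    rw [hpow, QuotientGroup.mk_mul, (QuotientGroup.eq_one_iff a).2 ha, one_mul]
  let e := MulEquiv.ofBijective pow ⟨hinj, hsurj⟩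
  refine ⟨e.symm.toMonoidHom.comp (QuotientGroup.mk' N), ?_, ?_⟩
  · exact e.symm_apply_eq.2 (by rw [← zpow_one t]; exact (hpow 1).symm)
  · exact (MonoidHom.ker_mulEquiv_comp _ e.symm).trans (QuotientGroup.ker_mk' N)

end Subgroups

section Lamps

open scoped commutatorElement

variable {P G : Type*} [Group P] [Group G] (t : P) (ι : G →* P)

/-- The copy of `G` at the site `k` of a lamplighter group: the conjugate by `t ^ k` of the copy `ι`
at the origin. -/
def lamp (k : ℤ) : G →* P :=
  (MulAut.conj (t ^ k)).toMonoidHom.comp ι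

/-- The subgroup generated by the lamps at the sites in `S` with states in the subgroup `Z`. -/
def lampSubgroup (Z : Subgroup G) (S : Set ℤ) : Subgroup P :=
  Subgroup.closure (image2 (fun k z => lamp t ι k z) S Z)

variable {t ι}

theorem lamp_apply (k : ℤ) (g : G) : lamp t ι k g = t ^ k * ι g * (t ^ k)⁻¹ :=
  rfl

@[simp]
theorem lamp_zero : lamp t ι 0 = ι := by
  ext g
  simp [lamp_apply]

theorem conj_apply_eq_lamp (n : ℤ) (g : G) : MulAut.conj (t ^ n) (ι g) = lamp t ι n g :=
  rfl

theorem conj_lamp (n k : ℤ) (g : G) :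
    MulAut.conj (t ^ n) (lamp t ι k g) = lamp t ι (n + k) g := by
  simp only [MulAut.conj_apply, lamp_apply, zpow_add]
  group

variable {Z : Subgroup G} {S T : Set ℤ}

theorem lamp_mem_lampSubgroup {k : ℤ} (hk : k ∈ S) {z : G} (hz : z ∈ Z) :
    lamp t ι k z ∈ lampSubgroup t ι Z S :=
  Subgroup.subset_closure (mem_image2_of_mem hk hz)

theorem apply_mem_lampSubgroup (hS : 0 ∈ S) {z : G} (hz : z ∈ Z) :
    ι z ∈ lampSubgroup t ι Z S := by
  simpa only [lamp_zero] using lamp_mem_lampSubgroup (t := t) (ι := ι) hS hz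

theorem lampSubgroup_le_iff {K : Subgroup P} :
    lampSubgroup t ι Z S ≤ K ↔ ∀ k ∈ S, ∀ z ∈ Z, lamp t ι k z ∈ K := by
  rw [lampSubgroup, Subgroup.closure_le, image2_subset_iff]
  rfl

theorem lampSubgroup_mono {Z' : Subgroup G} (hZ : Z ≤ Z') (hS : S ⊆ T) :
    lampSubgroup t ι Z S ≤ lampSubgroup t ι Z' T :=
  Subgroup.closure_mono (image2_subset hS hZ)

theorem lampSubgroup_union :
    lampSubgroup t ι Z (S ∪ T) = lampSubgroup t ι Z S ⊔ lampSubgroup t ι Z T := by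
  rw [lampSubgroup, image2_union_left, Subgroup.closure_union, lampSubgroup, lampSubgroup]

theorem lampSubgroup_singleton (k : ℤ) : lampSubgroup t ι Z {k} = Z.map (lamp t ι k) := by
  rw [lampSubgroup, image2_singleton_left, ← Subgroup.coe_map, Subgroup.closure_eq]

theorem map_conj_lampSubgroup (n : ℤ) :
    (lampSubgroup t ι Z S).map (MulAut.conj (t ^ n)).toMonoidHom =
      lampSubgroup t ι Z ((n + ·) '' S) := by
  rw [lampSubgroup, MonoidHom.map_closure, image_image2, lampSubgroup, image2_image_left]
  simp only [MulEquiv.coe_toMonoidHom, conj_lamp]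

theorem conj_mem_lampSubgroup {x : P} (hx : x ∈ lampSubgroup t ι Z S) (n : ℤ) :
    MulAut.conj (t ^ n) x ∈ lampSubgroup t ι Z ((n + ·) '' S) := by
  rw [← map_conj_lampSubgroup]
  exact Subgroup.mem_map_of_mem _ hx

theorem exists_mem_lampSubgroup_inter_Icc {x : P} (hx : x ∈ lampSubgroup t ι Z S) :
    ∃ d : ℕ, x ∈ lampSubgroup t ι Z (S ∩ Icc (-d) d) := by
  have hcover : S = ⋃ d : ℕ, S ∩ Icc (-(d : ℤ)) d := by
    rw [← inter_iUnion, eq_comm, inter_eq_left]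
    exact fun k _ => mem_iUnion.2 ⟨k.natAbs, by constructor <;> omega⟩
  have hmono : Monotone fun d : ℕ => lampSubgroup t ι Z (S ∩ Icc (-(d : ℤ)) d) := fun a b hab =>
    lampSubgroup_mono le_rfl (inter_subset_inter_right S (Icc_subset_Icc (by omega) (by omega)))
  rw [hcover, lampSubgroup, image2_iUnion_left, Subgroup.closure_iUnion] at hx
  exact (Subgroup.mem_iSup_of_directed hmono.directed_le).1 hx

theorem normal_lampSubgroup_univ (hgen : Subgroup.closure (insert t (range ι)) = ⊤) :
    (lampSubgroup t ι ⊤ univ).Normal := by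
  rw [← Subgroup.normalizer_eq_top_iff, ← top_le_iff, ← hgen, Subgroup.closure_le]
  rintro x (rfl | ⟨g, rfl⟩)
  · have hmap := map_conj_lampSubgroup (t := x) (ι := ι) (Z := ⊤) (S := univ) 1
    rw [zpow_one, image_univ_of_surjective (add_left_surjective (1 : ℤ))] at hmap
    exact Subgroup.mem_normalizer_iff_map_conj_eq.2 hmap
  · exact Subgroup.le_normalizer (apply_mem_lampSubgroup (mem_univ 0) (Subgroup.mem_top g))

theorem lampSubgroup_univ_sup_zpowers (hgen : Subgroup.closure (insert t (range ι)) = ⊤) :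
    lampSubgroup t ι ⊤ univ ⊔ Subgroup.zpowers t = ⊤ := by
  rw [← top_le_iff, ← hgen, Subgroup.closure_le]
  rintro x (rfl | ⟨g, rfl⟩)
  · exact Subgroup.mem_sup_right (Subgroup.mem_zpowers x)
  · exact Subgroup.mem_sup_left (apply_mem_lampSubgroup (mem_univ 0) (Subgroup.mem_top g))

/-- The relations which make the subgroups generated by lamps behave as in a cross-wired
lamplighter group: lamps in states from `Z` are central among all lamps, the commutator of two
lamps is a product of such lamps at sites between the two, and no nontrivial lamp is a product of
lamps at sites further to the right. -/
structure IsLampSystem (t : P) (ι : G →* P) (Z : Subgroup G) : Prop where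
  commute : ∀ (k : ℤ) (g : G), ∀ z ∈ Z, Commute (ι g) (lamp t ι k z)
  commutator_mem : ∀ (d : ℕ) (g h : G),
    ⁅ι g, lamp t ι (-d) h⁆ ∈ lampSubgroup t ι Z (Icc (-d) 0)
  eq_one : ∀ g, ι g ∈ lampSubgroup t ι ⊤ (Ioi 0) → g = 1

namespace IsLampSystem

theorem commute_lamp (h : IsLampSystem t ι Z) (j k : ℤ) (g : G) {z : G} (hz : z ∈ Z) :
    Commute (lamp t ι j g) (lamp t ι k z) := by
  have hconj := (h.commute (k - j) g z hz).map (MulAut.conj (t ^ j))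
  rwa [conj_apply_eq_lamp, conj_lamp, add_sub_cancel] at hconj

theorem commute_of_mem (h : IsLampSystem t ι Z) {x y : P} (hx : x ∈ lampSubgroup t ι ⊤ S)
    (hy : y ∈ lampSubgroup t ι Z T) : Commute x y := by
  have hcomm : ⁅lampSubgroup t ι ⊤ S, lampSubgroup t ι Z T⁆ ≤ ⊥ := by
    rw [le_bot_iff, Subgroup.commutator_eq_bot_iff_le_centralizer, lampSubgroup_le_iff]
    intro j _ g _
    rw [lampSubgroup, Subgroup.centralizer_closure, Subgroup.mem_centralizer_iff]
    rintro _ ⟨k, _, z, hz, rfl⟩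
    exact (h.commute_lamp j k g hz).symm
  exact (commutatorElement_eq_one_iff_commute).1 (hcomm (Subgroup.commutator_mem_commutator hx hy))

theorem commutator_lamp_mem (h : IsLampSystem t ι Z) (j k : ℤ) (g g' : G) :
    ⁅lamp t ι j g, lamp t ι k g'⁆ ∈ lampSubgroup t ι Z (uIcc j k) := by
  wlog hkj : k ≤ j generalizing j k g g'
  · rw [← commutatorElement_inv, uIcc_comm]
    exact inv_mem (this k j g' g (le_of_not_ge hkj))
  obtain ⟨d, rfl⟩ := Int.le.dest hkj
  have hconj := conj_mem_lampSubgroup (h.commutator_mem d g g') (k + d)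
  rw [map_commutatorElement, conj_apply_eq_lamp, conj_lamp, image_const_add_Icc, add_zero,
    add_neg_cancel_right] at hconj
  rwa [uIcc_of_ge hkj]

theorem commutator_lampSubgroup_le (h : IsLampSystem t ι Z) (hS : S.OrdConnected) :
    ⁅lampSubgroup t ι ⊤ S, lampSubgroup t ι ⊤ S⁆ ≤ lampSubgroup t ι Z S := by
  refine commutator_closure_le (le_trans ?_ (Subgroup.centralizer_le_normalizer _)) ?_
  · exact fun x hx => Subgroup.mem_centralizer_iff.2 fun y hy => (h.commute_of_mem hx hy).symm
  · rintro _ ⟨j, hj, g, -, rfl⟩ _ ⟨k, hk, g', -, rfl⟩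
    exact lampSubgroup_mono le_rfl (hS.uIcc_subset hj hk) (h.commutator_lamp_mem j k g g')

theorem exists_central_mul_eq (h : IsLampSystem t ι Z) {z : P}
    (hz : z ∈ lampSubgroup t ι Z (S ∪ T)) :
    ∃ z₁ ∈ lampSubgroup t ι Z S, ∃ z₂ ∈ lampSubgroup t ι Z T, z₁ * z₂ = z := by
  rw [lampSubgroup_union] at hz
  refine exists_mul_eq_of_mem_sup (fun a ha b hb => ⟨a, ha, b, hb, ?_⟩) hz
  exact h.commute_of_mem (lampSubgroup_mono le_top le_rfl ha) hb

theorem exists_mul_eq (h : IsLampSystem t ι Z) (hST : (S ∪ T).OrdConnected) {x : P}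
    (hx : x ∈ lampSubgroup t ι ⊤ (S ∪ T)) :
    ∃ a ∈ lampSubgroup t ι ⊤ S, ∃ b ∈ lampSubgroup t ι ⊤ T, a * b = x := by
  rw [lampSubgroup_union] at hx
  refine exists_mul_eq_of_mem_sup (fun a ha b hb => ?_) hx
  have ha' := lampSubgroup_mono (t := t) le_rfl (subset_union_left (t := T)) ha
  have hb' := lampSubgroup_mono (t := t) le_rfl (subset_union_right (s := S)) hb
  obtain ⟨z₁, hz₁, z₂, hz₂, hz⟩ := h.exists_central_mul_eq
    (h.commutator_lampSubgroup_le hST (Subgroup.commutator_mem_commutator hb' ha'))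
  refine ⟨z₁ * a, mul_mem (lampSubgroup_mono le_top le_rfl hz₁) ha,
    z₂ * b, mul_mem (lampSubgroup_mono le_top le_rfl hz₂) hb, ?_⟩
  calc z₁ * a * (z₂ * b) = z₁ * z₂ * (a * b) := (h.commute_of_mem ha hz₂).mul_mul_mul_comm z₁ b
    _ = ⁅b, a⁆ * (a * b) := by rw [hz]
    _ = b * a := by group

theorem lamp_eq_one (h : IsLampSystem t ι Z) {k : ℤ} {g : G}
    (hg : lamp t ι k g ∈ lampSubgroup t ι ⊤ (Ioi k)) : g = 1 := by
  refine h.eq_one g ?_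
  have hconj := conj_mem_lampSubgroup hg (-k)
  rwa [conj_lamp, image_const_add_Ioi, neg_add_cancel, lamp_zero] at hconj

theorem lamp_injective (h : IsLampSystem t ι Z) (k : ℤ) : Function.Injective (lamp t ι k) :=
  (injective_iff_map_eq_one _).2 fun _ hg => h.lamp_eq_one (hg ▸ one_mem _)

theorem disjoint_Ici_Ico (h : IsLampSystem t ι Z) (n : ℤ) (d : ℕ) :
    Disjoint (lampSubgroup t ι ⊤ (Ici n)) (lampSubgroup t ι ⊤ (Ico (n - d) n)) := by
  induction d with
  | zero => simp [lampSubgroup]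
  | succ d ih =>
    have hinsert : Ico (n - (d + 1 : ℕ)) n = {n - (d + 1)} ∪ Ico (n - d) n := by
      ext k
      simp only [mem_Ico, singleton_union, mem_insert_iff]
      omega
    rw [Subgroup.disjoint_def]
    intro x hx hx'
    rw [hinsert] at hx'
    obtain ⟨a, ha, b, hb, rfl⟩ := h.exists_mul_eq (hinsert ▸ ordConnected_Ico) hx'
    rw [lampSubgroup_singleton] at ha
    obtain ⟨g, -, rfl⟩ := ha
    have hg : lamp t ι (n - (d + 1)) g ∈ lampSubgroup t ι ⊤ (Ioi (n - (d + 1))) := by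
      rw [← mul_inv_cancel_right (lamp t ι (n - (d + 1)) g) b]
      refine mul_mem (lampSubgroup_mono le_rfl (Ici_subset_Ioi.2 (by omega)) hx)
        (inv_mem (lampSubgroup_mono le_rfl ?_ hb))
      exact Ico_subset_Ici_self.trans (Ici_subset_Ioi.2 (by omega))
    rw [h.lamp_eq_one hg, map_one, one_mul] at hx ⊢
    exact Subgroup.disjoint_def.1 ih hx hb

theorem disjoint_Ici_Iio (h : IsLampSystem t ι Z) (n : ℤ) :
    Disjoint (lampSubgroup t ι ⊤ (Ici n)) (lampSubgroup t ι ⊤ (Iio n)) := by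
  rw [Subgroup.disjoint_def]
  intro x hx hx'
  obtain ⟨d, hd⟩ := exists_mem_lampSubgroup_inter_Icc hx'
  have hsub : Iio n ∩ Icc (-(d : ℤ)) d ⊆ Ico (n - (d + n.natAbs : ℕ)) n := by
    rintro k ⟨hkn, hkd, -⟩
    exact ⟨by omega, hkn⟩
  exact Subgroup.disjoint_def.1 (h.disjoint_Ici_Ico n _) hx (lampSubgroup_mono le_rfl hsub hd)

theorem relIndex_union_singleton (h : IsLampSystem t ι Z) (k : ℤ) (hS : ({k} ∪ S).OrdConnected)
    (hkS : Disjoint (lampSubgroup t ι ⊤ {k}) (lampSubgroup t ι ⊤ S)) :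
    (lampSubgroup t ι ⊤ S).relIndex (lampSubgroup t ι ⊤ ({k} ∪ S)) = Nat.card G := by
  have hmul := fun x => h.exists_mul_eq (x := x) hS
  rw [lampSubgroup_union] at hmul ⊢
  rw [relIndex_sup_eq_card hkS hmul, lampSubgroup_singleton]
  exact (Subgroup.card_map_of_injective (h.lamp_injective k)).trans Subgroup.card_top

theorem eq_zero_of_zpow_mem [Nontrivial G] (h : IsLampSystem t ι Z) (n : ℤ)
    (hn : t ^ n ∈ lampSubgroup t ι ⊤ univ) : n = 0 := by
  by_contra hne
  wlog hpos : 0 < n generalizing n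
  · exact this (-n) (by rw [zpow_neg]; exact inv_mem hn) (by omega) (by omega)
  obtain ⟨d, hd⟩ := exists_mem_lampSubgroup_inter_Icc hn
  obtain ⟨g, hg⟩ := exists_ne (1 : G)
  have hsub : univ ∩ Icc (-(d : ℤ)) d ⊆ Ioi (-d - 1) := by
    rintro k ⟨-, hk, -⟩
    exact Int.sub_one_lt_of_le hk
  have ht := lampSubgroup_mono (t := t) le_rfl hsub hd
  refine hg (h.lamp_eq_one (k := -d - 1) ?_)
  have hconj := conj_lamp (t := t) (ι := ι) n (-d - 1) g
  have hlamp : lamp t ι (n + (-d - 1)) g ∈ lampSubgroup t ι ⊤ (Ioi (-d - 1)) :=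
    lamp_mem_lampSubgroup (by simp only [mem_Ioi]; omega) (Subgroup.mem_top g)
  rw [← hconj, MulAut.conj_apply] at hlamp
  simpa [mul_assoc] using mul_mem (mul_mem (inv_mem ht) hlamp) ht

theorem isConfining (h : IsLampSystem t ι Z) {lev : P →* Multiplicative ℤ} {n k : ℤ}
    (hlev : lev (t ^ n) = Multiplicative.ofAdd 1) (hker : lev.ker = lampSubgroup t ι ⊤ univ)
    (hS : S.OrdConnected) (hshift : {k} ∪ (n + ·) '' S = S)
    (hdisj : Disjoint (lampSubgroup t ι ⊤ {k}) (lampSubgroup t ι ⊤ ((n + ·) '' S)))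
    (habsorb : ∀ d : ℕ, ∃ m : ℕ, (n * m + ·) '' Icc (-d) d ⊆ S) :
    IsConfining lev (t ^ n) (Nat.card G) (lampSubgroup t ι ⊤ S) where
  level_eq := hlev
  le_ker := hker ▸ lampSubgroup_mono le_rfl (subset_univ S)
  map_conj_le := by
    rw [map_conj_lampSubgroup]
    exact lampSubgroup_mono le_rfl (subset_union_right.trans hshift.subset)
  relIndex_map_conj := by
    have hindex := h.relIndex_union_singleton k (hshift.symm ▸ hS) hdisj
    rwa [hshift, ← map_conj_lampSubgroup] at hindex
  exists_conj_pow_mem γ hγ := by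
    obtain ⟨d, hd⟩ := exists_mem_lampSubgroup_inter_Icc (hker ▸ hγ)
    obtain ⟨m, hm⟩ := habsorb d
    refine ⟨m, ?_⟩
    rw [← zpow_natCast, ← zpow_mul, ← MulAut.conj_apply]
    rw [univ_inter] at hd
    exact lampSubgroup_mono le_rfl hm (conj_mem_lampSubgroup hd _)

theorem isConfining_Ici (h : IsLampSystem t ι Z) {lev : P →* Multiplicative ℤ}
    (hlev : lev t = Multiplicative.ofAdd 1) (hker : lev.ker = lampSubgroup t ι ⊤ univ) :
    IsConfining lev t (Nat.card G) (lampSubgroup t ι ⊤ (Ici 0)) := by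
  rw [← zpow_one t] at hlev
  have hshift : {0} ∪ ((1 : ℤ) + ·) '' Ici 0 = Ici (0 : ℤ) := by
    rw [image_const_add_Ici]
    ext k
    simp only [singleton_union, mem_insert_iff, mem_Ici]
    omega
  have hdisj : Disjoint (lampSubgroup t ι ⊤ {0}) (lampSubgroup t ι ⊤ (((1 : ℤ) + ·) '' Ici 0)) := by
    rw [image_const_add_Ici]
    exact (h.disjoint_Ici_Iio (1 + 0)).symm.mono_left (lampSubgroup_mono le_rfl (by simp))
  have hconf := h.isConfining hlev hker ordConnected_Ici hshift hdisj fun d => ⟨d, ?_⟩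
  · rwa [zpow_one] at hconf
  · rw [image_const_add_Icc]
    exact fun k hk => by simp only [mem_Icc, mem_Ici] at *; omega

theorem isConfining_Iio (h : IsLampSystem t ι Z) {lev : P →* Multiplicative ℤ}
    (hlev : lev t⁻¹ = Multiplicative.ofAdd 1) (hker : lev.ker = lampSubgroup t ι ⊤ univ) :
    IsConfining lev t⁻¹ (Nat.card G) (lampSubgroup t ι ⊤ (Iio 0)) := by
  rw [← zpow_neg_one t] at hlev ⊢
  have hshift : {-1} ∪ ((-1 : ℤ) + ·) '' Iio 0 = Iio (0 : ℤ) := by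
    rw [image_const_add_Iio]
    ext k
    simp only [singleton_union, mem_insert_iff, mem_Iio]
    omega
  have hdisj :
      Disjoint (lampSubgroup t ι ⊤ {-1}) (lampSubgroup t ι ⊤ (((-1 : ℤ) + ·) '' Iio 0)) := by
    rw [image_const_add_Iio]
    exact (h.disjoint_Ici_Iio (-1 + 0)).mono_left (lampSubgroup_mono le_rfl (by simp))
  refine h.isConfining hlev hker ordConnected_Iio hshift hdisj fun d => ⟨d + 1, ?_⟩
  rw [image_const_add_Icc]
  exact fun k hk => by simp only [mem_Icc, mem_Iio] at *; push_cast at hk; omega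

theorem isCrossWiredLamplighter [Finite G] [Nontrivial G] (h : IsLampSystem t ι Z)
    (hgen : Subgroup.closure (insert t (range ι)) = ⊤) : IsCrossWiredLamplighter P := by
  have := normal_lampSubgroup_univ hgen
  obtain ⟨lev, hlev, hker⟩ := exists_hom_ker_eq_of_sup_zpowers_eq_top
    (lampSubgroup_univ_sup_zpowers hgen) h.eq_zero_of_zpow_mem
  have hlev_inv : lev⁻¹ t⁻¹ = Multiplicative.ofAdd 1 := by
    rw [MonoidHom.inv_apply, map_inv, inv_inv, hlev]
  have hker_inv : lev⁻¹.ker = lampSubgroup t ι ⊤ univ := by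
    rw [← hker]
    ext γ
    simp [MonoidHom.mem_ker]
  refine isCrossWiredLamplighter_of_isConfining (Finite.one_lt_card (α := G))
    (h.isConfining_Ici hlev hker) (h.isConfining_Iio hlev_inv hker_inv)
    (h.disjoint_Ici_Iio 0) fun γ hγ => ?_
  · have hcover : Ici 0 ∪ Iio 0 = (univ : Set ℤ) := Ici_union_Iio
    exact h.exists_mul_eq (hcover ▸ ordConnected_univ) (by rwa [hcover, ← hker])

end IsLampSystem

section Pullback

variable {Q : Type*} [Group Q] (f : P →* Q)

theorem map_lampSubgroup :
    (lampSubgroup t ι Z S).map f = lampSubgroup (f t) (f.comp ι) Z S := by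
  rw [lampSubgroup, MonoidHom.map_closure, image_image2, lampSubgroup]
  simp only [lamp_apply, map_mul, map_zpow, map_inv, MonoidHom.comp_apply]

variable {f}

theorem mem_lampSubgroup_of_injective (hf : Function.Injective f) {x : P} :
    f x ∈ lampSubgroup (f t) (f.comp ι) Z S ↔ x ∈ lampSubgroup t ι Z S := by
  rw [← map_lampSubgroup, Subgroup.mem_map_iff_mem hf]

theorem IsLampSystem.of_injective (hf : Function.Injective f)
    (h : IsLampSystem (f t) (f.comp ι) Z) : IsLampSystem t ι Z where
  commute k g z hz := by
    have hcomm := h.commute k g z hz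
    rw [lamp_apply, MonoidHom.comp_apply, MonoidHom.comp_apply] at hcomm
    refine Commute.of_map hf ?_
    simpa only [lamp_apply, map_mul, map_zpow, map_inv] using hcomm
  commutator_mem d g g' := by
    rw [← mem_lampSubgroup_of_injective hf]
    simpa only [lamp_apply, map_commutatorElement, map_mul, map_zpow, map_inv, MonoidHom.comp_apply]
      using h.commutator_mem d g g'
  eq_one g hg := h.eq_one g ((mem_lampSubgroup_of_injective hf).2 hg)

end Pullback

end Lamps

section WordMaps

variable {A : Type*} [Group A]

/-- The shift of infinite words to the right, with the letter `1` inserted in front. -/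
def delay (A : Type*) [Group A] : (ℕ → A) →* (ℕ → A) where
  toFun w n := n.casesOn 1 w
  map_one' := by
    funext n
    cases n <;> rfl
  map_mul' v w := by
    funext n
    cases n
    · exact (mul_one 1).symm
    · rfl

@[simp]
theorem delay_zero (w : ℕ → A) : delay A w 0 = 1 :=
  rfl

@[simp]
theorem delay_succ (w : ℕ → A) (n : ℕ) : delay A w (n + 1) = w n :=
  rfl

/-- The transformation `a₁a₂a₃⋯ ↦ (a₁)(a₁a₂)(a₁a₂a₃)⋯` of infinite words over a group: the
state `1` of its Cayley machine. -/
def partialProd (A : Type*) [Group A] : Equiv.Perm (ℕ → A) :=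
  (cayleyMachine A).statePerm 1

theorem statePerm_cayleyMachine_zero (g : A) (w : ℕ → A) :
    (cayleyMachine A).statePerm g w 0 = g * w 0 :=
  rfl

theorem statePerm_cayleyMachine_succ (g : A) (w : ℕ → A) (n : ℕ) :
    (cayleyMachine A).statePerm g w (n + 1) = (cayleyMachine A).statePerm g w n * w (n + 1) :=
  rfl

@[simp]
theorem partialProd_zero (w : ℕ → A) : partialProd A w 0 = w 0 :=
  one_mul (w 0)

@[simp]
theorem partialProd_succ (w : ℕ → A) (n : ℕ) :
    partialProd A w (n + 1) = partialProd A w n * w (n + 1) :=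
  rfl

theorem delay_partialProd_mul (w : ℕ → A) : delay A (partialProd A w) * w = partialProd A w := by
  funext n
  cases n <;> simp

theorem partialProd_inv_apply (v : ℕ → A) : (partialProd A)⁻¹ v = (delay A v)⁻¹ * v := by
  rw [eq_inv_mul_iff_mul_eq]
  simpa using delay_partialProd_mul ((partialProd A)⁻¹ v)

/-- The left regular action of the group of infinite words over `A` on itself. -/
def leftMul (A : Type*) [Group A] : (ℕ → A) →* Equiv.Perm (ℕ → A) :=
  MulAction.toPermHom (ℕ → A) (ℕ → A)

@[simp]
theorem leftMul_apply (v w : ℕ → A) : leftMul A v w = v * w :=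
  rfl

/-- The action of `A` on infinite words by left multiplication of the first letter. -/
def firstMul (A : Type*) [Group A] : A →* Equiv.Perm (ℕ → A) :=
  (leftMul A).comp (MonoidHom.mulSingle (fun _ => A) 0)

theorem firstMul_apply (g : A) (w : ℕ → A) : firstMul A g w = Pi.mulSingle 0 g * w :=
  rfl

theorem firstMul_injective : Function.Injective (firstMul A) := by
  intro g h hgh
  simpa [firstMul_apply] using congrFun (DFunLike.congr_fun hgh 1) 0

theorem statePerm_cayleyMachine (g : A) :
    (cayleyMachine A).statePerm g = partialProd A * firstMul A g := by
  ext w n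
  rw [Equiv.Perm.mul_apply, firstMul_apply]
  induction n with
  | zero => simp [statePerm_cayleyMachine_zero]
  | succ n ih => rw [statePerm_cayleyMachine_succ, ih, partialProd_succ]; simp

theorem partialProd_mem {K : Subgroup A} {w : ℕ → A} (hw : ∀ n, w n ∈ K) (n : ℕ) :
    partialProd A w n ∈ K := by
  induction n with
  | zero => simpa using hw 0
  | succ n ih => exact mul_mem ih (hw (n + 1))

@[simp]
theorem partialProd_mulSingle (g : A) (n : ℕ) : partialProd A (Pi.mulSingle 0 g) n = g := by
  induction n with
  | zero => simp
  | succ n ih => simp [ih]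

theorem partialProd_eq_of_le {w : ℕ → A} {d : ℕ} (hw : ∀ n, d + 1 ≤ n → w n = 1) {n : ℕ}
    (hn : d ≤ n) : partialProd A w n = partialProd A w d := by
  induction n, hn using Nat.le_induction with
  | base => rfl
  | succ n hn ih => rw [partialProd_succ, ih, hw (n + 1) (by omega), mul_one]

theorem map_partialProd_mul {H : Type*} [Group H] (f : A →* H) {v w : ℕ → A}
    (hcomm : ∀ m n, Commute (f (v m)) (f (partialProd A w n))) (n : ℕ) :
    f (partialProd A (v * w) n) = f (partialProd A v n) * f (partialProd A w n) := by
  induction n with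
  | zero => simp
  | succ n ih =>
    simp only [partialProd_succ, Pi.mul_apply, map_mul, ih]
    exact ((hcomm (n + 1) n).symm).mul_mul_mul_comm _ _

end WordMaps

section CentralWords

variable {A : Type*} [Group A]

theorem mem_center_pi {z : ℕ → A} :
    z ∈ Subgroup.center (ℕ → A) ↔ ∀ n, z n ∈ Subgroup.center A := by
  simp [Subgroup.center_pi, Subgroup.mem_pi]

theorem mulSingle_mem_center {z : A} (hz : z ∈ Subgroup.center A) :
    Pi.mulSingle 0 z ∈ Subgroup.center (ℕ → A) := by
  rw [mem_center_pi]
  rintro (_ | n)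
  exacts [by simpa using hz, by simp [one_mem]]

theorem delay_mem_center {z : ℕ → A} (hz : z ∈ Subgroup.center (ℕ → A)) :
    delay A z ∈ Subgroup.center (ℕ → A) := by
  rw [mem_center_pi] at hz ⊢
  rintro (_ | n)
  exacts [one_mem _, hz n]

theorem partialProd_mem_center {z : ℕ → A} (hz : z ∈ Subgroup.center (ℕ → A)) :
    partialProd A z ∈ Subgroup.center (ℕ → A) :=
  mem_center_pi.2 (partialProd_mem (mem_center_pi.1 hz))

theorem partialProd_mul_of_mem_center {z : ℕ → A} (hz : z ∈ Subgroup.center (ℕ → A))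
    (w : ℕ → A) : partialProd A (z * w) = partialProd A z * partialProd A w :=
  funext <| map_partialProd_mul (MonoidHom.id A) fun m _ =>
    (Subgroup.mem_center_iff.1 (mem_center_pi.1 hz m) _).symm

/-- The group of translations of the infinite words by central words. -/
def centralTranslations (A : Type*) [Group A] : Subgroup (Equiv.Perm (ℕ → A)) :=
  (Subgroup.center (ℕ → A)).map (leftMul A)

theorem conj_partialProd_leftMul {z : ℕ → A} (hz : z ∈ Subgroup.center (ℕ → A)) :
    partialProd A * leftMul A z * (partialProd A)⁻¹ =
      leftMul A (partialProd A z) := by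
  ext w : 1
  simp [partialProd_mul_of_mem_center hz]

theorem partialProd_mem_normalizer_centralTranslations :
    partialProd A ∈ Subgroup.normalizer (centralTranslations A : Set (Equiv.Perm (ℕ → A))) := by
  refine Subgroup.mem_normalizer_iff.2 fun x => ⟨?_, ?_⟩
  · rintro ⟨z, hz, rfl⟩
    exact ⟨partialProd A z, partialProd_mem_center hz, (conj_partialProd_leftMul hz).symm⟩
  · rintro ⟨y, hy, hyx⟩
    have hz : (partialProd A)⁻¹ y ∈ Subgroup.center (ℕ → A) :=
      partialProd_inv_apply y ▸ mul_mem (inv_mem (delay_mem_center hy)) hy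
    refine ⟨(partialProd A)⁻¹ y, hz, ?_⟩
    have hconj := conj_partialProd_leftMul hz
    rw [show partialProd A ((partialProd A)⁻¹ y) = y from
      (partialProd A).apply_symm_apply y, hyx] at hconj
    exact mul_left_cancel (mul_right_cancel hconj)

theorem commute_of_mem_centralTranslations {x : Equiv.Perm (ℕ → A)}
    (hx : x ∈ centralTranslations A) (g : A) : Commute (firstMul A g) x := by
  obtain ⟨z, hz, rfl⟩ := hx
  exact Commute.map (show Commute _ z from Subgroup.mem_center_iff.1 hz _) (leftMul A)

theorem lamp_mem_centralTranslations (k : ℤ) {z : A} (hz : z ∈ Subgroup.center A) :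
    lamp (partialProd A) (firstMul A) k z ∈ centralTranslations A := by
  have hfirst : firstMul A z ∈ centralTranslations A := ⟨_, mulSingle_mem_center hz, rfl⟩
  exact (Subgroup.mem_normalizer_iff.1
    (zpow_mem partialProd_mem_normalizer_centralTranslations k) _).1 hfirst

theorem leftMul_mem_lampSubgroup {z : ℕ → A} (hz : z ∈ Subgroup.center (ℕ → A)) (d : ℕ)
    (hzd : ∀ n, d ≤ n → z n = 1) :
    leftMul A z ∈
      lampSubgroup (partialProd A) (firstMul A) (Subgroup.center A) (Ioc (-d) 0) := by
  induction d generalizing z with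
  | zero =>
    rw [show z = 1 from funext fun n => hzd n n.zero_le, map_one]
    exact one_mem _
  | succ d ih =>
    set c := partialProd A z d
    have hc_mem : c ∈ Subgroup.center A := partialProd_mem (mem_center_pi.1 hz) d
    have hsingle := mulSingle_mem_center (inv_mem hc_mem)
    set x : ℕ → A := Pi.mulSingle 0 c⁻¹ * z with hx
    have hx_mem : x ∈ Subgroup.center (ℕ → A) := mul_mem hsingle hz
    have hxd (n : ℕ) (hn : d ≤ n) : partialProd A x n = 1 := by
      rw [hx, partialProd_mul_of_mem_center hsingle, Pi.mul_apply, partialProd_mulSingle,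
        partialProd_eq_of_le hzd hn, inv_mul_cancel]
    have hx_lamp := conj_mem_lampSubgroup (ih (partialProd_mem_center hx_mem) hxd) (-1)
    rw [← conj_partialProd_leftMul hx_mem, ← MulAut.conj_apply, zpow_neg_one, ← MulAut.mul_apply,
      ← map_mul, inv_mul_cancel, map_one, MulAut.one_apply, image_const_add_Ioc] at hx_lamp
    have hz_eq : leftMul A z = firstMul A c * leftMul A x := by
      rw [hx, map_mul, ← mul_assoc, firstMul, MonoidHom.comp_apply, MonoidHom.mulSingle_apply,
        ← map_mul, ← Pi.mulSingle_mul, mul_inv_cancel, Pi.mulSingle_one, map_one, one_mul]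
    rw [hz_eq]
    refine mul_mem (apply_mem_lampSubgroup (mem_Ioc.2 ⟨by omega, le_rfl⟩) hc_mem)
      (lampSubgroup_mono le_rfl ?_ hx_lamp)
    exact Ioc_subset_Ioc (by push_cast; omega) (by simp)

end CentralWords

section TailFixing

variable {A : Type*}

/-- The permutations of the infinite words which change none of the letters from position `d` on. -/
def tailFixing (A : Type*) (d : ℕ) : Subgroup (Equiv.Perm (ℕ → A)) where
  carrier := {f | ∀ w n, d ≤ n → f w n = w n}
  one_mem' _ _ _ := rfl
  mul_mem' {f g} hf hg w n hn := (hf (g w) n hn).trans (hg w n hn)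
  inv_mem' {f} hf w n hn := by simpa using (hf (f⁻¹ w) n hn).symm

theorem tailFixing_mono {d e : ℕ} (hde : d ≤ e) : tailFixing A d ≤ tailFixing A e :=
  fun _ hf w n hn => hf w n (hde.trans hn)

variable [Group A]

theorem conj_partialProd_inv_apply_succ (f : Equiv.Perm (ℕ → A)) (w : ℕ → A) (n : ℕ) :
    ((partialProd A)⁻¹ * f * partialProd A) w (n + 1) =
      (f (partialProd A w) n)⁻¹ * f (partialProd A w) (n + 1) := by
  rw [Equiv.Perm.mul_apply, Equiv.Perm.mul_apply, partialProd_inv_apply]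
  simp

theorem conj_mem_tailFixing {f : Equiv.Perm (ℕ → A)} {d : ℕ} (hf : f ∈ tailFixing A d) :
    (partialProd A)⁻¹ * f * partialProd A ∈ tailFixing A (d + 1) := by
  rintro w (_ | n) hn
  · omega
  · rw [conj_partialProd_inv_apply_succ, hf _ n (by omega), hf _ (n + 1) (by omega)]
    simp

theorem mem_tailFixing_of_conj_mem {f : Equiv.Perm (ℕ → A)} {d : ℕ}
    (hf : f ∈ tailFixing A (d + 1))
    (hconj : (partialProd A)⁻¹ * f * partialProd A ∈ tailFixing A (d + 1)) :
    f ∈ tailFixing A d := by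
  intro v n hn
  rcases hn.eq_or_lt with rfl | hn
  · obtain ⟨w, rfl⟩ := (partialProd A).surjective v
    have h := hconj w (d + 1) le_rfl
    rw [conj_partialProd_inv_apply_succ, hf _ (d + 1) le_rfl] at h
    rwa [partialProd_succ, ← mul_assoc, mul_eq_right, inv_mul_eq_one] at h
  · exact hf v n hn

theorem lamp_neg_succ (d : ℕ) (g : A) :
    lamp (partialProd A) (firstMul A) (-(d + 1 : ℕ)) g =
      (partialProd A)⁻¹ * lamp (partialProd A) (firstMul A) (-d) g * partialProd A := by
  have h := conj_lamp (t := partialProd A) (ι := firstMul A) (-1) (-d) g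
  rw [MulAut.conj_apply, zpow_neg_one, inv_inv] at h
  rw [h]
  congr 2
  push_cast
  ring

theorem lamp_neg_mem_tailFixing (d : ℕ) (g : A) :
    lamp (partialProd A) (firstMul A) (-d) g ∈ tailFixing A (d + 1) := by
  induction d with
  | zero =>
    rintro w (_ | n) hn
    · omega
    · simp [firstMul_apply]
  | succ d ih => exact lamp_neg_succ d g ▸ conj_mem_tailFixing ih

theorem eq_one_of_lamp_neg_mem_tailFixing {d : ℕ} {g : A}
    (h : lamp (partialProd A) (firstMul A) (-d) g ∈ tailFixing A d) : g = 1 := by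
  induction d with
  | zero =>
    have hfix : firstMul A g = 1 := by
      ext w n
      simpa using h w n n.zero_le
    exact firstMul_injective (hfix.trans (map_one _).symm)
  | succ d ih =>
    rw [lamp_neg_succ] at h
    exact ih (mem_tailFixing_of_conj_mem (lamp_neg_mem_tailFixing d g) h)

theorem lampSubgroup_Ioc_le_tailFixing (d : ℕ) :
    lampSubgroup (partialProd A) (firstMul A) ⊤ (Ioc (-d) 0) ≤ tailFixing A d := by
  rw [lampSubgroup_le_iff]
  rintro k ⟨hdk, hk⟩ g -
  obtain ⟨e, rfl⟩ := Int.exists_eq_neg_ofNat hk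
  exact tailFixing_mono (by omega) (lamp_neg_mem_tailFixing e g)

theorem eq_one_of_firstMul_mem_lampSubgroup {g : A}
    (hg : firstMul A g ∈ lampSubgroup (partialProd A) (firstMul A) ⊤ (Ioi 0)) : g = 1 := by
  obtain ⟨d, hd⟩ := exists_mem_lampSubgroup_inter_Icc hg
  have hconj := conj_mem_lampSubgroup hd (-d)
  rw [conj_apply_eq_lamp] at hconj
  refine eq_one_of_lamp_neg_mem_tailFixing (lampSubgroup_Ioc_le_tailFixing d ?_)
  refine lampSubgroup_mono le_rfl ?_ hconj
  rintro _ ⟨k, ⟨hk, -, hkd⟩, rfl⟩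
  simp only [mem_Ioi, mem_Ioc] at *
  omega

end TailFixing

section ClassTwo

open scoped commutatorElement IsMulCommutative

theorem commutatorElement_mem_center_of_nilpotencyClass_le_two {G : Type*} [Group G]
    [Group.IsNilpotent G] (hG : Group.nilpotencyClass G ≤ 2) (a b : G) :
    ⁅a, b⁆ ∈ Subgroup.center G := by
  rw [← Subgroup.upperCentralSeries_one]
  refine Subgroup.mem_upperCentralSeries_succ_iff.1 ?_ b
  rw [Subgroup.upperCentralSeries_eq_top_iff_nilpotencyClass_le.2 hG]
  exact Subgroup.mem_top a

theorem commutatorElement_mem_center_pi {A : Type*} [Group A]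
    (hA : ∀ a b : A, ⁅a, b⁆ ∈ Subgroup.center A) (v w : ℕ → A) :
    ⁅v, w⁆ ∈ Subgroup.center (ℕ → A) :=
  mem_center_pi.2 fun n => hA (v n) (w n)

/-- The homomorphism `x ↦ ⁅a, x⁆` of a group of nilpotency class at most two into its centre. -/
def commutatorHom {H : Type*} [Group H] (hH : ∀ a b : H, ⁅a, b⁆ ∈ Subgroup.center H) (a : H) :
    H →* Subgroup.center H where
  toFun x := ⟨⁅a, x⁆, hH a x⟩
  map_one' := Subtype.ext (commutatorElement_one_right a)
  map_mul' x y := by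
    ext
    have hcomm : x * ⁅a, y⁆ = ⁅a, y⁆ * x := Subgroup.mem_center_iff.1 (hH a y) x
    calc ⁅a, x * y⁆ = ⁅a, x⁆ * (x * ⁅a, y⁆ * x⁻¹) := by group
      _ = ⁅a, x⁆ * ⁅a, y⁆ := by rw [hcomm, mul_inv_cancel_right]

variable {A : Type*} [Group A]

/-- A left translation of the group of infinite words, twisted by a homomorphism into its centre
which kills the centre. Over a group of nilpotency class at most two, unlike the translations, these
permutations are stable under conjugation by `(partialProd A)⁻¹`. -/
def IsTwistedTranslation (f : Equiv.Perm (ℕ → A)) : Prop :=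
  ∃ (a : ℕ → A) (B : (ℕ → A) →* Subgroup.center (ℕ → A)),
    Subgroup.center (ℕ → A) ≤ B.ker ∧ ∀ w, f w = a * w * B w

theorem isTwistedTranslation_leftMul (a : ℕ → A) : IsTwistedTranslation (leftMul A a) :=
  ⟨a, 1, fun _ _ => rfl, fun w => by simp⟩

theorem IsTwistedTranslation.commutator_leftMul_mem
    (hA : ∀ a b : A, ⁅a, b⁆ ∈ Subgroup.center A) {f : Equiv.Perm (ℕ → A)}
    (hf : IsTwistedTranslation f) (u : ℕ → A) : ⁅leftMul A u, f⁆ ∈ centralTranslations A := by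
  obtain ⟨a, B, -, hf⟩ := hf
  refine ⟨⁅u, a⁆ * (B u)⁻¹, mul_mem (commutatorElement_mem_center_pi hA u a)
    (inv_mem (B u).2), ?_⟩
  have hcentral (x : ℕ → A) : Commute x (B u : ℕ → A)⁻¹ :=
    Subgroup.mem_center_iff.1 (inv_mem (B u).2) x
  have hinv (w : ℕ → A) : f (u⁻¹ * w) = a * (u⁻¹ * w) * (B w * (B u : ℕ → A)⁻¹) := by
    rw [hf, map_mul, map_inv, mul_comm (B u)⁻¹]
    rfl
  rw [eq_comm, commutatorElement_def, mul_inv_eq_iff_eq_mul, ← map_inv]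
  ext w : 1
  calc (leftMul A u * f * leftMul A u⁻¹) w = u * f (u⁻¹ * w) := rfl
    _ = u * (a * (u⁻¹ * w) * B w) * (B u : ℕ → A)⁻¹ := by rw [hinv]; group
    _ = ⁅u, a⁆ * (a * w * B w) * (B u : ℕ → A)⁻¹ := by group
    _ = ⁅u, a⁆ * (B u : ℕ → A)⁻¹ * (a * w * B w) := by
        rw [mul_assoc, (hcentral _).eq, ← mul_assoc]
    _ = (leftMul A (⁅u, a⁆ * (B u : ℕ → A)⁻¹) * f) w := by rw [← hf]; rfl

theorem exists_comp_partialProd (hA : ∀ a b : A, ⁅a, b⁆ ∈ Subgroup.center A) {C : Type*} [Group C]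
    {D : (ℕ → A) →* C} (hD : Subgroup.center (ℕ → A) ≤ D.ker) :
    ∃ B : (ℕ → A) →* C, Subgroup.center (ℕ → A) ≤ B.ker ∧ ∀ w, B w = D (partialProd A w) := by
  have hcomm (a b : A) :
      Commute (QuotientGroup.mk' (Subgroup.center A) a) (QuotientGroup.mk' _ b) := by
    rw [← commutatorElement_eq_one_iff_commute, ← map_commutatorElement, ← MonoidHom.mem_ker,
      QuotientGroup.ker_mk']
    exact hA a b
  have hmul (v w : ℕ → A) :
      (partialProd A (v * w))⁻¹ * (partialProd A v * partialProd A w) ∈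
        Subgroup.center (ℕ → A) := by
    refine mem_center_pi.2 fun n => QuotientGroup.eq.1 ?_
    exact map_partialProd_mul (QuotientGroup.mk' _) (fun _ _ => hcomm _ _) n
  refine ⟨MonoidHom.mk' (fun w => D (partialProd A w)) fun v w => ?_,
    fun z hz => hD (partialProd_mem_center hz), fun _ => rfl⟩
  rw [← map_mul, ← inv_mul_eq_one, ← map_inv, ← map_mul]
  exact hD (hmul v w)

/-- The restriction of `delay` to central words. -/
def centralDelay (A : Type*) [Group A] :
    Subgroup.center (ℕ → A) →* Subgroup.center (ℕ → A) :=
  ((delay A).comp (Subgroup.subtype _)).codRestrict _ fun z => delay_mem_center z.2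

theorem IsTwistedTranslation.conj_partialProd (hA : ∀ a b : A, ⁅a, b⁆ ∈ Subgroup.center A)
    {f : Equiv.Perm (ℕ → A)} (hf : IsTwistedTranslation f) :
    IsTwistedTranslation ((partialProd A)⁻¹ * f * partialProd A) := by
  obtain ⟨a, B, hB, hf⟩ := hf
  let α := (delay A a)⁻¹ * a
  let C := (commutatorHom (commutatorElement_mem_center_pi hA) α⁻¹).comp (delay A)
  let D := C⁻¹ * B * ((centralDelay A).comp B)⁻¹
  have hD : Subgroup.center (ℕ → A) ≤ D.ker := by
    intro z hz
    have hBz : B z = 1 := hB hz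
    have hCz : C z = 1 := Subtype.ext <| commutatorElement_eq_one_iff_commute.2 <|
      Subgroup.mem_center_iff.1 (delay_mem_center hz) α⁻¹
    simp [D, MonoidHom.mem_ker, hBz, hCz]
  obtain ⟨B', hB', hB'_apply⟩ := exists_comp_partialProd hA hD
  refine ⟨α, B', hB', fun w => ?_⟩
  obtain ⟨v, rfl⟩ := (partialProd A)⁻¹.surjective w
  have hcomm (z : Subgroup.center (ℕ → A)) (x : ℕ → A) : Commute x z :=
    Subgroup.mem_center_iff.1 z.2 x
  have hC : (delay A v)⁻¹ * α = α * (delay A v)⁻¹ * (C v : ℕ → A)⁻¹ := by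
    rw [show (C v : ℕ → A) = ⁅α⁻¹, delay A v⁆ from rfl]
    group
  calc ((partialProd A)⁻¹ * f * partialProd A) ((partialProd A)⁻¹ v)
      = (delay A (a * v * B v))⁻¹ * (a * v * B v) := by
        rw [← hf, ← partialProd_inv_apply]
        simp
    _ = (centralDelay A (B v) : ℕ → A)⁻¹ * (((delay A v)⁻¹ * α) * v * B v) := by
        rw [map_mul, map_mul]
        simp only [α, mul_inv_rev, mul_assoc]
        rfl
    _ = α * ((delay A v)⁻¹ * v) * ((C v : ℕ → A)⁻¹ * B v * (centralDelay A (B v) : ℕ → A)⁻¹) := by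
        rw [hC, ← ((hcomm _ _).inv_right).eq, mul_assoc _ (C v : ℕ → A)⁻¹ v,
          ← ((hcomm (C v) v).inv_right).eq]
        simp only [mul_assoc]
    _ = α * (partialProd A)⁻¹ v * B' ((partialProd A)⁻¹ v) := by
        rw [partialProd_inv_apply, hB'_apply, ← partialProd_inv_apply]
        simp [D]

theorem isTwistedTranslation_lamp_neg (hA : ∀ a b : A, ⁅a, b⁆ ∈ Subgroup.center A) (d : ℕ)
    (h : A) : IsTwistedTranslation (lamp (partialProd A) (firstMul A) (-d) h) := by
  induction d with
  | zero =>
    rw [Nat.cast_zero, neg_zero, lamp_zero]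
    exact isTwistedTranslation_leftMul (Pi.mulSingle 0 h)
  | succ d ih => exact lamp_neg_succ d h ▸ ih.conj_partialProd hA

theorem commutator_firstMul_lamp_mem (hA : ∀ a b : A, ⁅a, b⁆ ∈ Subgroup.center A) (d : ℕ)
    (g h : A) : ⁅firstMul A g, lamp (partialProd A) (firstMul A) (-d) h⁆ ∈
      lampSubgroup (partialProd A) (firstMul A) (Subgroup.center A) (Icc (-d) 0) := by
  have hg : firstMul A g ∈ tailFixing A 1 := by simpa using lamp_neg_mem_tailFixing 0 g
  have hfix : ⁅firstMul A g, lamp (partialProd A) (firstMul A) (-d) h⁆ ∈ tailFixing A (d + 1) :=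
    Subgroup.commutator_le_self _ <| Subgroup.commutator_mem_commutator
      (tailFixing_mono (Nat.le_add_left 1 d) hg) (lamp_neg_mem_tailFixing d h)
  obtain ⟨z, hz, hz_eq⟩ : ⁅firstMul A g, _⁆ ∈ centralTranslations A :=
    (isTwistedTranslation_lamp_neg hA d h).commutator_leftMul_mem hA (Pi.mulSingle 0 g)
  rw [← hz_eq] at hfix ⊢
  have hz_one (n : ℕ) (hn : d + 1 ≤ n) : z n = 1 := by simpa using hfix 1 n hn
  refine lampSubgroup_mono le_rfl ?_ (leftMul_mem_lampSubgroup hz (d + 1) hz_one)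
  rintro k ⟨hk, hk0⟩
  exact ⟨by push_cast at hk; omega, hk0⟩

theorem isLampSystem_firstMul (hA : ∀ a b : A, ⁅a, b⁆ ∈ Subgroup.center A) :
    IsLampSystem (partialProd A) (firstMul A) (Subgroup.center A) where
  commute k g _ hz := commute_of_mem_centralTranslations (lamp_mem_centralTranslations k hz) g
  commutator_mem := commutator_firstMul_lamp_mem hA
  eq_one _ := eq_one_of_firstMul_mem_lampSubgroup

end ClassTwo

section AutomataGroup

open scoped commutatorElement

variable (A : Type*) [Group A]

theorem partialProd_mem_automataGroup : partialProd A ∈ (cayleyMachine A).automataGroup :=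
  Subgroup.subset_closure ⟨1, rfl⟩

variable {A} in
theorem firstMul_mem_automataGroup (g : A) : firstMul A g ∈ (cayleyMachine A).automataGroup := by
  have hg : (cayleyMachine A).statePerm g ∈ (cayleyMachine A).automataGroup :=
    Subgroup.subset_closure ⟨g, rfl⟩
  rw [statePerm_cayleyMachine] at hg
  exact (Subgroup.mul_mem_cancel_left _ (partialProd_mem_automataGroup A)).1 hg

/-- The transformation `partialProd` as an element of the automata group. -/
def automataTranslation : (cayleyMachine A).automataGroup :=
  ⟨partialProd A, partialProd_mem_automataGroup A⟩

/-- The action `firstMul` as a homomorphism into the automata group. -/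
def automataLamp : A →* (cayleyMachine A).automataGroup :=
  (firstMul A).codRestrict _ firstMul_mem_automataGroup

theorem isLampSystem_automataLamp (hA : ∀ a b : A, ⁅a, b⁆ ∈ Subgroup.center A) :
    IsLampSystem (automataTranslation A) (automataLamp A) (Subgroup.center A) :=
  .of_injective (Subgroup.subtype_injective _) (isLampSystem_firstMul hA)

theorem closure_insert_automataTranslation :
    Subgroup.closure (insert (automataTranslation A) (range (automataLamp A))) = ⊤ := by
  have htop : Subgroup.closure (((↑) : (cayleyMachine A).automataGroup → Equiv.Perm (ℕ → A)) ⁻¹'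
      range (cayleyMachine A).statePerm) = ⊤ := Subgroup.closure_closure_coe_preimage
  rw [eq_top_iff, ← htop, Subgroup.closure_le]
  rintro x ⟨g, hg⟩
  have hx : x = automataTranslation A * automataLamp A g :=
    Subtype.ext (hg.symm.trans (statePerm_cayleyMachine g))
  rw [hx]
  exact mul_mem (Subgroup.subset_closure (mem_insert _ _))
    (Subgroup.subset_closure (mem_insert_of_mem _ (mem_range_self g)))

end AutomataGroup

theorem theorem2 (G : Type*) [Group G] [Finite G] [Nontrivial G] [Group.IsNilpotent G]
    (hG : Group.nilpotencyClass G ≤ 2) :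
    IsCrossWiredLamplighter (cayleyMachine G).automataGroup := by
  have hlamp : IsLampSystem (automataTranslation G) (automataLamp G) (Subgroup.center G) :=
    isLampSystem_automataLamp G (commutatorElement_mem_center_of_nilpotencyClass_le_two hG)
  exact hlamp.isCrossWiredLamplighter (closure_insert_automataTranslation G)
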